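/- Let \(m=2d_1\ge 4\) and \(n=2d_2\ge 4\) be even integers, let \(\omega=e^{2\pi i/3}\), and let \(|0\rangle,\dots,|m-1\rangle\) and \(|0\rangle,\dots,|n-1\rangle\) be the standard bases of \(\mathbb{C}^m\) (Alice) and \(\mathbb{C}^n\) (Bob). Consider in \(\mathbb{C}^m\otimes\mathbb{C}^n\) the following (not normalized) product vectors, where \(t\in\{0,1,2\}\), \(0\le\delta\le d_2-3\), \(0\le\sigma\le d_1-3\) (there are no vectors with index \(\delta\) if \(d_2=2\), and none with index \(\sigma\) if \(d_1=2\)): \[ \begin{aligned} &|0\rangle_A\Big(\sum_{j=0}^{2}\omega^{tj}|j\rangle\Big)_B, && |0\rangle_A\big(|2\delta+3\rangle\pm|2\delta+4\rangle\big)_B,\\ &\Big(\sum_{j=0}^{2}\omega^{tj}|j\rangle\Big)_A|n-1\rangle_B, && \big(|2\sigma+3\rangle\pm|2\sigma+4\rangle\big)_A|n-1\rangle_B,\\ &|m-1\rangle_A\Big(\sum_{j=0}^{2}\omega^{tj}|j+1\rangle\Big)_B, && |m-1\rangle_A\big(|2\delta+4\rangle\pm|2\delta+5\rangle\big)_B,\\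 &\Big(\sum_{j=0}^{2}\omega^{tj}|j+1\rangle\Big)_A|0\rangle_B, && \big(|2\sigma+4\rangle\pm|2\sigma+5\rangle\big)_A|0\rangle_B. \end{aligned} \] These are \(2(m+n)-4\) distinct nonzero, mutually orthogonal product vectors, and they cannot be perfectly distinguished by local operations and classical communication (LOCC): there is no protocol, with finitely or infinitely many rounds, in which Alice and Bob in turn perform local quantum measurements with finitely many outcomes, each chosen according to the previously announced outcomes, that identifies, with probability 1, which of the (normalized) states they were given. (A protocol with infinitely many rounds identifies the state with probability 1 if, for guesses made after each finite number of rounds, the probability of a correct guess tends to 1 for each of the states.) -/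

import Mathlib

open scoped Kronecker Matrix Topology

noncomputable section

/-! ### Vectors of `ℂᵃ ⊗ ℂᵇ`, as arrays of coordinates in the product basis -/

/-- The (not necessarily normalized) vectors of `ℂᵃ ⊗ ℂᵇ`. -/
abbrev BipartiteVector (a b : ℕ) : Type := Fin a × Fin b → ℂ

/-- The product vector `|u⟩_A |v⟩_B`. -/
def productVector {a b : ℕ} (u : Fin a → ℂ) (v : Fin b → ℂ) : BipartiteVector a b :=
  fun p => u p.1 * v p.2

/-- The squared norm `⟨x|x⟩`. -/
def sqNorm {a b : ℕ} (x : BipartiteVector a b) : ℝ := ∑ p, ‖x p‖ ^ 2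

/-! ### Local operations and classical communication -/

/-- Protocols of local operations and classical communication with finitely many rounds, for
parties Alice and Bob holding systems `ℂᵃ` and `ℂᵇ`, that end with the announcement of an
element of `I`. In a round one party performs a quantum measurement, given by Kraus operators
`M j` with `∑ j, (M j)ᴴ * M j = 1` (with arbitrary output dimensions, so that local ancillas
and isometries are included), and broadcasts the outcome `j`; everything that happens
afterwards may depend on `j`. -/
inductive LOCCProtocol (I : Type) : ℕ → ℕ → Type
  | guess {a b : ℕ} (g : I) : LOCCProtocol I a b
  | alice {a b : ℕ} (k : ℕ) (a' : Fin k → ℕ) (M : ∀ j, Matrix (Fin (a' j)) (Fin a) ℂ)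
      (hM : ∑ j, (M j)ᴴ * M j = 1) (next : ∀ j, LOCCProtocol I (a' j) b) : LOCCProtocol I a b
  | bob {a b : ℕ} (k : ℕ) (b' : Fin k → ℕ) (M : ∀ j, Matrix (Fin (b' j)) (Fin b) ℂ)
      (hM : ∑ j, (M j)ᴴ * M j = 1) (next : ∀ j, LOCCProtocol I a (b' j)) : LOCCProtocol I a b

namespace LOCCProtocol

variable {I : Type}

open Classical in
/-- The total squared norm of the branches of the protocol, run on `x`, that announce `i`.
For a unit vector `x` this is the probability that `i` is announced. -/
def weight : {a b : ℕ} → LOCCProtocol I a b → I → BipartiteVector a b → ℝ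
  | _, _, guess g, i, x => if g = i then sqNorm x else 0
  | _, b, alice _ _ M _ next, i, x =>
      ∑ j, weight (next j) i ((M j ⊗ₖ (1 : Matrix (Fin b) (Fin b) ℂ)) *ᵥ x)
  | a, _, bob _ _ M _ next, i, x =>
      ∑ j, weight (next j) i (((1 : Matrix (Fin a) (Fin a) ℂ) ⊗ₖ M j) *ᵥ x)

/-- The probability that `i` is announced when the protocol is run on the normalized
state `x / ‖x‖`, for `x ≠ 0`. -/
def prob {a b : ℕ} (P : LOCCProtocol I a b) (i : I) (x : BipartiteVector a b) : ℝ :=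
  P.weight i x / sqNorm x

/-- `Q` performs the measurements of `P`, and then possibly continues with further rounds
instead of announcing the answers of `P`. -/
def ContinuedBy : {a b : ℕ} → LOCCProtocol I a b → LOCCProtocol I a b → Prop
  | _, _, guess _, _ => True
  | _, _, alice k a' M hM next, Q =>
      ∃ next', Q = alice k a' M hM next' ∧ ∀ j, ContinuedBy (next j) (next' j)
  | _, _, bob k b' M hM next, Q =>
      ∃ next', Q = bob k b' M hM next' ∧ ∀ j, ContinuedBy (next j) (next' j)

end LOCCProtocol

/-- The family `φ` of nonzero vectors of `ℂᵃ ⊗ ℂᵇ` can be perfectly distinguished by LOCC: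
there is an LOCC protocol, of possibly infinitely many rounds, that identifies each `φ i` with
probability 1. The protocol is given by its successive finite parts `P 0, P 1, …`, each
continuing the preceding one; a protocol with finitely many rounds is a constant sequence, and
it has to identify each `φ i` with probability exactly 1. -/
def LOCCDistinguishable {I : Type} {a b : ℕ} (φ : I → BipartiteVector a b) : Prop :=
  ∃ P : ℕ → LOCCProtocol I a b, (∀ N, (P N).ContinuedBy (P (N + 1))) ∧
    ∀ i, Filter.Tendsto (fun N => (P N).prob i (φ i)) Filter.atTop (𝓝 1)

/-! ### The states -/

/-- The primitive cube root of unity `e^{2πi/3}`. -/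
def omega : ℂ := Complex.exp (2 * Real.pi * Complex.I / 3)

/-- The basis vector `|k⟩` of `ℂᴺ`, `0 ≤ k < N`. -/
def ket (N k : ℕ) : Fin N → ℂ := fun i => if (i : ℕ) = k then 1 else 0

/-- Labels of the `2 * d - 1` states of a strip: `t = 0, 1, 2` for the block of three, and a
pair `δ = 0, …, d - 3` with a sign, `true` for `+` and `false` for `-`. -/
abbrev StripLabel (d : ℕ) : Type := Fin 3 ⊕ Fin (d - 2) × Bool

/-- The vectors of a strip that starts at `|s⟩` in `ℂᴺ`:
`∑ j, ω^(t j) |j + s⟩` and `|2δ + 3 + s⟩ ± |2δ + 4 + s⟩`. -/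
def stripVector (N s : ℕ) {d : ℕ} : StripLabel d → Fin N → ℂ
  | Sum.inl t => ∑ j : Fin 3, omega ^ ((t : ℕ) * (j : ℕ)) • ket N ((j : ℕ) + s)
  | Sum.inr (δ, true) => ket N (2 * (δ : ℕ) + 3 + s) + ket N (2 * (δ : ℕ) + 4 + s)
  | Sum.inr (δ, false) => ket N (2 * (δ : ℕ) + 3 + s) - ket N (2 * (δ : ℕ) + 4 + s)

/-- Labels of the states of the four boundary strips of the `2d₁ × 2d₂` grid. -/
inductive StateLabel (d₁ d₂ : ℕ) : Type
  | top (l : StripLabel d₂) : StateLabel d₁ d₂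
  | right (l : StripLabel d₁) : StateLabel d₁ d₂
  | bottom (l : StripLabel d₂) : StateLabel d₁ d₂
  | left (l : StripLabel d₁) : StateLabel d₁ d₂

/-- The states: `|0⟩_A |v⟩_B`, `|u⟩_A |n-1⟩_B`, `|m-1⟩_A |v'⟩_B` and `|u'⟩_A |0⟩_B`, where `u`, `v`
run through the strip vectors that start at `|0⟩`, and `u'`, `v'` through those that start
at `|1⟩`, with `m = 2 * d₁` and `n = 2 * d₂`. -/
def boundaryState (d₁ d₂ m n : ℕ) : StateLabel d₁ d₂ → BipartiteVector m n
  | StateLabel.top l => productVector (ket m 0) (stripVector n 0 l)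
  | StateLabel.right l => productVector (stripVector m 0 l) (ket n (n - 1))
  | StateLabel.bottom l => productVector (ket m (m - 1)) (stripVector n 1 l)
  | StateLabel.left l => productVector (stripVector m 1 l) (ket n 0)

end

noncomputable section


/-! ### Squared norms and inner products -/

/-! Call a family rigid for a party if any local operator of that party, next to a nonzero multiple
of an isometry on the other side, must itself be a multiple of an isometry as soon as the images of
the family stay orthogonal. A protocol on a family rigid for both parties learns nothing. Success in
the limit passes to every branch, because the deficit of one branch is at most the total deficit.
The overlap of two states is bounded by their error weights (`norm_star_dotProduct_le_of_ne`), so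
the states on each branch are exactly orthogonal, even with infinitely many rounds. By rigidity the
accumulated operators are multiples of isometries, so each finite part announces `i` with a
probability independent of the state (`exists_weight_eq_mul_sqNorm`). For two labels these
probabilities sum to at most 1, yet both should tend to 1.

The states are rigid for Alice (Bob is symmetric) because `E = Aᴴ * A` is forced to be scalar
(`StripDiagonal.eq_smul_one`). States in one strip share Bob's vector, so `E` is diagonal in the
vectors of both of Alice's strips, whose blocks are {0,1,2},{3,4},… and {1,2,3},{4,5},…. Adjacent
strips with overlapping Bob vectors isolate |0⟩ and |m-1⟩. Entries between different blocks of
either strip vanish, which leaves only those between |1⟩ and |2⟩; the Fourier triple makes its block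
circulant, so these equal entries at |0⟩, which are zero. Triples and pairs have constant diagonal,
and the staggered blocks link all diagonal entries. -/

theorem sqNorm_nonneg {a b : ℕ} (x : BipartiteVector a b) : 0 ≤ sqNorm x :=
  Finset.sum_nonneg fun _ _ => by positivity

theorem sqNorm_pos {a b : ℕ} {x : BipartiteVector a b} (hx : x ≠ 0) : 0 < sqNorm x := by
  obtain ⟨p, hp⟩ := Function.ne_iff.1 hx
  exact Finset.sum_pos' (fun _ _ => by positivity)
    ⟨p, Finset.mem_univ _, by have := norm_pos_iff.2 hp; positivity⟩

theorem star_dotProduct_self {a b : ℕ} (x : BipartiteVector a b) :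
    star x ⬝ᵥ x = (sqNorm x : ℂ) := by
  simp only [dotProduct, sqNorm, Pi.star_apply, Complex.ofReal_sum]
  refine Finset.sum_congr rfl fun p _ => ?_
  rw [Complex.star_def, Complex.conj_mul']
  norm_cast

theorem norm_star_dotProduct_le {a b : ℕ} (x y : BipartiteVector a b) :
    ‖star x ⬝ᵥ y‖ ≤ √(sqNorm x) * √(sqNorm y) := by
  calc ‖star x ⬝ᵥ y‖ ≤ ∑ p, ‖x p‖ * ‖y p‖ := by
        refine (norm_sum_le _ _).trans (Finset.sum_le_sum fun p _ => ?_)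
        simp
    _ ≤ _ := Real.sum_mul_le_sqrt_mul_sqrt _ _ _

theorem star_mulVec_dotProduct_mulVec {ι κ : Type*} [Fintype ι] [Fintype κ]
    (M : Matrix ι κ ℂ) (x y : κ → ℂ) :
    star (M *ᵥ x) ⬝ᵥ (M *ᵥ y) = star x ⬝ᵥ ((Mᴴ * M) *ᵥ y) := by
  rw [Matrix.star_mulVec, ← Matrix.dotProduct_mulVec, Matrix.mulVec_mulVec]

theorem sum_star_mulVec_dotProduct_mulVec {a b k : ℕ} {ι : Fin k → Type*} [∀ j, Fintype (ι j)]
    (M : ∀ j, Matrix (ι j) (Fin a × Fin b) ℂ) (hM : ∑ j, (M j)ᴴ * M j = 1)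
    (x y : BipartiteVector a b) :
    ∑ j, star (M j *ᵥ x) ⬝ᵥ (M j *ᵥ y) = star x ⬝ᵥ y := by
  simp only [star_mulVec_dotProduct_mulVec]
  rw [← dotProduct_sum, ← Matrix.sum_mulVec, hM, Matrix.one_mulVec]

theorem sum_kronecker_one {a b k : ℕ} {a' : Fin k → ℕ} (M : ∀ j, Matrix (Fin (a' j)) (Fin a) ℂ)
    (hM : ∑ j, (M j)ᴴ * M j = 1) :
    ∑ j, (M j ⊗ₖ (1 : Matrix (Fin b) (Fin b) ℂ))ᴴ * (M j ⊗ₖ (1 : Matrix (Fin b) (Fin b) ℂ)) = 1 := by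
  simp only [Matrix.conjTranspose_kronecker, ← Matrix.mul_kronecker_mul, Matrix.conjTranspose_one,
    Matrix.one_mul]
  ext ⟨i, i'⟩ ⟨j, j'⟩
  have := congrFun (congrFun hM i) j
  simp only [Matrix.sum_apply] at this
  simp only [Matrix.sum_apply, Matrix.kronecker_apply, ← Finset.sum_mul, this,
    Matrix.one_apply, Prod.mk.injEq]
  split_ifs <;> simp_all

theorem sum_one_kronecker {a b k : ℕ} {b' : Fin k → ℕ} (M : ∀ j, Matrix (Fin (b' j)) (Fin b) ℂ)
    (hM : ∑ j, (M j)ᴴ * M j = 1) :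
    ∑ j, ((1 : Matrix (Fin a) (Fin a) ℂ) ⊗ₖ M j)ᴴ * ((1 : Matrix (Fin a) (Fin a) ℂ) ⊗ₖ M j) = 1 := by
  simp only [Matrix.conjTranspose_kronecker, ← Matrix.mul_kronecker_mul, Matrix.conjTranspose_one,
    Matrix.one_mul]
  ext ⟨i, i'⟩ ⟨j, j'⟩
  have := congrFun (congrFun hM i') j'
  simp only [Matrix.sum_apply] at this
  simp only [Matrix.sum_apply, Matrix.kronecker_apply, ← Finset.mul_sum, this,
    Matrix.one_apply, Prod.mk.injEq]
  split_ifs <;> simp_all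

theorem sum_sqNorm_alice {a b k : ℕ} {a' : Fin k → ℕ} (M : ∀ j, Matrix (Fin (a' j)) (Fin a) ℂ)
    (hM : ∑ j, (M j)ᴴ * M j = 1) (x : BipartiteVector a b) :
    ∑ j, sqNorm ((M j ⊗ₖ (1 : Matrix (Fin b) (Fin b) ℂ)) *ᵥ x) = sqNorm x := by
  have := sum_star_mulVec_dotProduct_mulVec _ (sum_kronecker_one (b := b) M hM) x x
  simp only [star_dotProduct_self] at this
  exact_mod_cast this

theorem sum_sqNorm_bob {a b k : ℕ} {b' : Fin k → ℕ} (M : ∀ j, Matrix (Fin (b' j)) (Fin b) ℂ)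
    (hM : ∑ j, (M j)ᴴ * M j = 1) (x : BipartiteVector a b) :
    ∑ j, sqNorm (((1 : Matrix (Fin a) (Fin a) ℂ) ⊗ₖ M j) *ᵥ x) = sqNorm x := by
  have := sum_star_mulVec_dotProduct_mulVec _ (sum_one_kronecker (a := a) M hM) x x
  simp only [star_dotProduct_self] at this
  exact_mod_cast this

/-! ### Weights of protocols -/

namespace LOCCProtocol

variable {I : Type}

theorem weight_nonneg {a b : ℕ} (P : LOCCProtocol I a b) (i : I) (x : BipartiteVector a b) :
    0 ≤ P.weight i x := by
  induction P with
  | guess g =>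
    rw [weight]
    split_ifs
    exacts [sqNorm_nonneg x, le_rfl]
  | alice k a' M hM next ih => exact Finset.sum_nonneg fun j _ => ih j _
  | bob k b' M hM next ih => exact Finset.sum_nonneg fun j _ => ih j _

theorem sum_weight_le {a b : ℕ} (P : LOCCProtocol I a b) (s : Finset I)
    (x : BipartiteVector a b) : ∑ i ∈ s, P.weight i x ≤ sqNorm x := by
  classical
  induction P with
  | guess g =>
    simp only [weight, Finset.sum_ite_eq]
    split_ifs
    exacts [le_rfl, sqNorm_nonneg x]
  | alice k a' M hM next ih =>
    simp only [weight]
    rw [Finset.sum_comm, ← sum_sqNorm_alice M hM x]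
    exact Finset.sum_le_sum fun j _ => ih j _
  | bob k b' M hM next ih =>
    simp only [weight]
    rw [Finset.sum_comm, ← sum_sqNorm_bob M hM x]
    exact Finset.sum_le_sum fun j _ => ih j _

theorem weight_le {a b : ℕ} (P : LOCCProtocol I a b) (i : I) (x : BipartiteVector a b) :
    P.weight i x ≤ sqNorm x := by
  simpa using P.sum_weight_le {i} x

/-- The inner product of two vectors is controlled by the weights of the wrong answers. -/
theorem norm_star_dotProduct_le_of_ne {a b : ℕ} (P : LOCCProtocol I a b) {i j : I} (hij : i ≠ j)
    (x y : BipartiteVector a b) :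
    ‖star x ⬝ᵥ y‖ ≤ √(sqNorm x - P.weight i x) * √(sqNorm y) +
      √(sqNorm x) * √(sqNorm y - P.weight j y) := by
  -- Cauchy–Schwarz over the measurement outcomes, for each of the two terms of the bound.
  have step : ∀ {k : ℕ} (A B C D : Fin k → ℝ), (∀ l, 0 ≤ A l) → (∀ l, 0 ≤ B l) →
      (∀ l, 0 ≤ C l) → (∀ l, 0 ≤ D l) →
      ∑ l, (√(A l) * √(B l) + √(C l) * √(D l)) ≤
        √(∑ l, A l) * √(∑ l, B l) + √(∑ l, C l) * √(∑ l, D l) := by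
    intro k A B C D hA hB hC hD
    rw [Finset.sum_add_distrib]
    exact add_le_add (Real.sum_sqrt_mul_sqrt_le _ hA hB) (Real.sum_sqrt_mul_sqrt_le _ hC hD)
  induction P with
  | guess g =>
    have h := norm_star_dotProduct_le x y
    have h0 : 0 ≤ √(sqNorm x) * √(sqNorm y) := by positivity
    simp only [weight]
    -- A leaf cannot announce both `i` and `j`, so at least one of the two terms is the full
    -- Cauchy–Schwarz bound.
    split_ifs with h1 h2 h2
    · exact absurd (h1.symm.trans h2) hij
    · simpa using h
    · simpa using h
    · simp only [sub_zero]; linarith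
  | alice k a' M hM next ih =>
    have hx := sum_sqNorm_alice M hM x
    have hy := sum_sqNorm_alice M hM y
    rw [← sum_star_mulVec_dotProduct_mulVec _ (sum_kronecker_one M hM) x y]
    refine (norm_sum_le _ _).trans ((Finset.sum_le_sum fun l _ => ih l _ _).trans ?_)
    refine (step _ _ _ _ (fun l => sub_nonneg.2 (weight_le _ _ _)) (fun l => sqNorm_nonneg _)
      (fun l => sqNorm_nonneg _) (fun l => sub_nonneg.2 (weight_le _ _ _))).trans ?_
    simp only [Finset.sum_sub_distrib, hx, hy, weight, le_refl]
  | bob k b' M hM next ih =>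
    have hx := sum_sqNorm_bob M hM x
    have hy := sum_sqNorm_bob M hM y
    rw [← sum_star_mulVec_dotProduct_mulVec _ (sum_one_kronecker M hM) x y]
    refine (norm_sum_le _ _).trans ((Finset.sum_le_sum fun l _ => ih l _ _).trans ?_)
    refine (step _ _ _ _ (fun l => sub_nonneg.2 (weight_le _ _ _)) (fun l => sqNorm_nonneg _)
      (fun l => sqNorm_nonneg _) (fun l => sub_nonneg.2 (weight_le _ _ _))).trans ?_
    simp only [Finset.sum_sub_distrib, hx, hy, weight, le_refl]

/-! ### Continued protocols and identification in the limit. -/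

theorem ContinuedBy.refl {a b : ℕ} (P : LOCCProtocol I a b) : P.ContinuedBy P := by
  induction P with
  | guess g => trivial
  | alice k a' M hM next ih => exact ⟨next, rfl, ih⟩
  | bob k b' M hM next ih => exact ⟨next, rfl, ih⟩

theorem ContinuedBy.trans {a b : ℕ} {P Q R : LOCCProtocol I a b} (h : P.ContinuedBy Q)
    (h' : Q.ContinuedBy R) : P.ContinuedBy R := by
  induction P with
  | guess g => trivial
  | alice k a' M hM next ih =>
    obtain ⟨next', rfl, hn⟩ := h
    obtain ⟨next'', rfl, hn'⟩ := h'
    exact ⟨next'', rfl, fun j => ih j (hn j) (hn' j)⟩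
  | bob k b' M hM next ih =>
    obtain ⟨next', rfl, hn⟩ := h
    obtain ⟨next'', rfl, hn'⟩ := h'
    exact ⟨next'', rfl, fun j => ih j (hn j) (hn' j)⟩

/-- The protocols `Q N` identify each of the vectors `x i` with probability tending to 1. -/
def Identifies {a b : ℕ} (Q : ℕ → LOCCProtocol I a b) (x : I → BipartiteVector a b) : Prop :=
  ∀ i, Filter.Tendsto (fun N => (Q N).weight i (x i)) Filter.atTop (𝓝 (sqNorm (x i)))

/-- The error weights in `norm_star_dotProduct_le_of_ne` tend to 0, while the overlap they bound
does not depend on `N`. -/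
theorem Identifies.orthogonal {a b : ℕ} {Q : ℕ → LOCCProtocol I a b}
    {x : I → BipartiteVector a b} (h : Identifies Q x) {i j : I} (hij : i ≠ j) :
    star (x i) ⬝ᵥ x j = 0 := by
  have hlim : Filter.Tendsto (fun N => √(sqNorm (x i) - (Q N).weight i (x i)) * √(sqNorm (x j)) +
      √(sqNorm (x i)) * √(sqNorm (x j) - (Q N).weight j (x j))) Filter.atTop
      (𝓝 (√(sqNorm (x i) - sqNorm (x i)) * √(sqNorm (x j)) +
        √(sqNorm (x i)) * √(sqNorm (x j) - sqNorm (x j)))) :=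
    (((tendsto_const_nhds.sub (h i)).sqrt).mul_const _).add
      ((tendsto_const_nhds.sub (h j)).sqrt.const_mul _)
  simp only [sub_self, Real.sqrt_zero, zero_mul, mul_zero, add_zero] at hlim
  have := ge_of_tendsto' hlim fun N => (Q N).norm_star_dotProduct_le_of_ne hij (x i) (x j)
  exact norm_le_zero_iff.1 this

/-- The deficit `c j - f N j` of one term is at most the total deficit. This carries identification
over to each branch of a measurement. -/
theorem tendsto_of_tendsto_sum {k : ℕ} {f : ℕ → Fin k → ℝ} {c : Fin k → ℝ}
    (hle : ∀ N j, f N j ≤ c j)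
    (h : Filter.Tendsto (fun N => ∑ j, f N j) Filter.atTop (𝓝 (∑ j, c j))) (j : Fin k) :
    Filter.Tendsto (fun N => f N j) Filter.atTop (𝓝 (c j)) := by
  have h0 : Filter.Tendsto (fun N => c j - (∑ j, c j - ∑ j, f N j)) Filter.atTop (𝓝 (c j)) := by
    simpa using (tendsto_const_nhds (x := c j)).sub ((tendsto_const_nhds (x := ∑ j, c j)).sub h)
  refine tendsto_of_tendsto_of_tendsto_of_le_of_le h0 tendsto_const_nhds (fun N => ?_)
    fun N => hle N j
  have := Finset.single_le_sum (f := fun j => c j - f N j) (fun l _ => sub_nonneg.2 (hle N l))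
    (Finset.mem_univ j)
  rw [Finset.sum_sub_distrib] at this
  simp only
  linarith

theorem sqNorm_kronecker_mulVec {a b a₀ b₀ : ℕ} {A : Matrix (Fin a) (Fin a₀) ℂ}
    {B : Matrix (Fin b) (Fin b₀) ℂ} {α β : ℂ} (hα : Aᴴ * A = α • 1) (hβ : Bᴴ * B = β • 1)
    (x : BipartiteVector a₀ b₀) :
    (sqNorm ((A ⊗ₖ B) *ᵥ x) : ℂ) = α * β * sqNorm x := by
  rw [← star_dotProduct_self, star_mulVec_dotProduct_mulVec, Matrix.conjTranspose_kronecker,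
    ← Matrix.mul_kronecker_mul, hα, hβ, Matrix.smul_kronecker, Matrix.kronecker_smul, smul_smul,
    Matrix.one_kronecker_one, Matrix.smul_mulVec, Matrix.one_mulVec, dotProduct_smul,
    star_dotProduct_self, smul_eq_mul]

/-- Covers the branches of probability zero, where rigidity says nothing because it asks for a
nonzero multiple of an isometry. -/
theorem weight_kronecker_mulVec_eq_zero {a b a₀ b₀ : ℕ} {A : Matrix (Fin a) (Fin a₀) ℂ}
    {B : Matrix (Fin b) (Fin b₀) ℂ} {α β : ℂ} (hα : Aᴴ * A = α • 1) (hβ : Bᴴ * B = β • 1)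
    (h0 : α * β = 0) (P : LOCCProtocol I a b) (i : I) (x : BipartiteVector a₀ b₀) :
    P.weight i ((A ⊗ₖ B) *ᵥ x) = 0 := by
  have h1 : sqNorm ((A ⊗ₖ B) *ᵥ x) = 0 := by
    have := sqNorm_kronecker_mulVec hα hβ x
    rw [h0, zero_mul] at this
    exact_mod_cast this
  exact le_antisymm ((P.weight_le i _).trans h1.le) (P.weight_nonneg i _)

theorem Identifies.alice_branch {a b k : ℕ} {a' : Fin k → ℕ}
    {M : ∀ j, Matrix (Fin (a' j)) (Fin a) ℂ} {hM : ∑ j, (M j)ᴴ * M j = 1}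
    {Q : ℕ → LOCCProtocol I a b} {next : ℕ → ∀ j, LOCCProtocol I (a' j) b}
    (hQ : ∀ N, Q N = alice k a' M hM (next N)) {x : I → BipartiteVector a b}
    (h : Identifies Q x) (j : Fin k) :
    Identifies (fun N => next N j)
      fun i => (M j ⊗ₖ (1 : Matrix (Fin b) (Fin b) ℂ)) *ᵥ x i := by
  intro i
  have hi := h i
  simp only [hQ, weight, ← sum_sqNorm_alice M hM (x i)] at hi
  exact tendsto_of_tendsto_sum
    (f := fun N j => (next N j).weight i ((M j ⊗ₖ (1 : Matrix (Fin b) (Fin b) ℂ)) *ᵥ x i))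
    (fun N j => weight_le _ _ _) hi j

theorem Identifies.bob_branch {a b k : ℕ} {b' : Fin k → ℕ}
    {M : ∀ j, Matrix (Fin (b' j)) (Fin b) ℂ} {hM : ∑ j, (M j)ᴴ * M j = 1}
    {Q : ℕ → LOCCProtocol I a b} {next : ℕ → ∀ j, LOCCProtocol I a (b' j)}
    (hQ : ∀ N, Q N = bob k b' M hM (next N)) {x : I → BipartiteVector a b}
    (h : Identifies Q x) (j : Fin k) :
    Identifies (fun N => next N j)
      fun i => ((1 : Matrix (Fin a) (Fin a) ℂ) ⊗ₖ M j) *ᵥ x i := by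
  intro i
  have hi := h i
  simp only [hQ, weight, ← sum_sqNorm_bob M hM (x i)] at hi
  exact tendsto_of_tendsto_sum
    (f := fun N j => (next N j).weight i (((1 : Matrix (Fin a) (Fin a) ℂ) ⊗ₖ M j) *ᵥ x i))
    (fun N j => weight_le _ _ _) hi j

/-- Every local operator on Alice's side, combined with a nonzero multiple of an isometry on Bob's
side, that keeps the `φ i` mutually orthogonal is a multiple of an isometry. -/
def _root_.AliceRigid {a₀ b₀ : ℕ} (φ : I → BipartiteVector a₀ b₀) : Prop :=
  ∀ (a b : ℕ) (A : Matrix (Fin a) (Fin a₀) ℂ) (B : Matrix (Fin b) (Fin b₀) ℂ) (β : ℂ),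
    β ≠ 0 → Bᴴ * B = β • 1 →
    (∀ i j, i ≠ j → star ((A ⊗ₖ B) *ᵥ φ i) ⬝ᵥ ((A ⊗ₖ B) *ᵥ φ j) = 0) → ∃ α : ℂ, Aᴴ * A = α • 1

/-- The counterpart of `AliceRigid` with the roles of the parties exchanged. -/
def _root_.BobRigid {a₀ b₀ : ℕ} (φ : I → BipartiteVector a₀ b₀) : Prop :=
  ∀ (a b : ℕ) (A : Matrix (Fin a) (Fin a₀) ℂ) (B : Matrix (Fin b) (Fin b₀) ℂ) (α : ℂ),
    α ≠ 0 → Aᴴ * A = α • 1 →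
    (∀ i j, i ≠ j → star ((A ⊗ₖ B) *ᵥ φ i) ⬝ᵥ ((A ⊗ₖ B) *ᵥ φ j) = 0) → ∃ β : ℂ, Bᴴ * B = β • 1

/-- The finite parts of a protocol that identifies a family which is rigid for both parties cannot
tell its members apart. -/
theorem exists_weight_eq_mul_sqNorm {a₀ b₀ : ℕ} {φ : I → BipartiteVector a₀ b₀}
    (hA : AliceRigid φ) (hB : BobRigid φ)
    {a b : ℕ} (P : LOCCProtocol I a b) (Q : ℕ → LOCCProtocol I a b)
    (hQ : ∀ N, P.ContinuedBy (Q N)) (A : Matrix (Fin a) (Fin a₀) ℂ) (B : Matrix (Fin b) (Fin b₀) ℂ)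
    (α β : ℂ) (hα : Aᴴ * A = α • 1) (hβ : Bᴴ * B = β • 1)
    (hI : Identifies Q fun i => (A ⊗ₖ B) *ᵥ φ i) :
    ∃ w : I → ℝ, ∀ i l, P.weight i ((A ⊗ₖ B) *ᵥ φ l) = w i * sqNorm (φ l) := by
  classical
  -- The induction runs over the finite part `P`; the sequence `Q` of its continuations supplies the
  -- orthogonality at each node.
  induction P generalizing α β with
  | guess g =>
    refine ⟨fun i => if g = i then (α * β).re else 0, fun i l => ?_⟩
    have := congrArg Complex.re (sqNorm_kronecker_mulVec hα hβ (φ l))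
    rw [Complex.re_mul_ofReal, Complex.ofReal_re] at this
    simp only [weight, this]
    split_ifs <;> simp
  | @alice a b k a' M hM next ih =>
    by_cases h0 : α * β = 0
    · exact ⟨0, fun i l => by
        rw [weight_kronecker_mulVec_eq_zero hα hβ h0, Pi.zero_apply, zero_mul]⟩
    -- Every `Q N` starts with the measurement of `P`, so all of them branch in the same way.
    choose nx hnx hcont using hQ
    have hmul : ∀ j l, (M j ⊗ₖ (1 : Matrix (Fin b) (Fin b) ℂ)) *ᵥ ((A ⊗ₖ B) *ᵥ φ l) =
        ((M j * A) ⊗ₖ B) *ᵥ φ l := by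
      intro j l
      rw [Matrix.mulVec_mulVec, ← Matrix.mul_kronecker_mul, Matrix.one_mul]
    have hw : ∀ j, ∃ w : I → ℝ, ∀ i l,
        (next j).weight i (((M j * A) ⊗ₖ B) *ᵥ φ l) = w i * sqNorm (φ l) := by
      intro j
      -- The states on branch `j` are still identified in the limit, hence orthogonal, so rigidity
      -- applies to `M j * A`.
      have hbr := hI.alice_branch hnx j
      simp only [hmul] at hbr
      obtain ⟨α', hα'⟩ := hA _ _ (M j * A) B β (right_ne_zero_of_mul h0) hβ
        fun i l hil => hbr.orthogonal hil
      exact ih j (fun N => nx N j) (fun N => hcont N j) _ _ α' β hα' hβ hbr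
    choose w hw using hw
    refine ⟨fun i => ∑ j, w j i, fun i l => ?_⟩
    simp only [weight, hmul, hw, Finset.sum_mul]
  | @bob a b k b' M hM next ih =>
    by_cases h0 : α * β = 0
    · exact ⟨0, fun i l => by
        rw [weight_kronecker_mulVec_eq_zero hα hβ h0, Pi.zero_apply, zero_mul]⟩
    choose nx hnx hcont using hQ
    have hmul : ∀ j l, ((1 : Matrix (Fin a) (Fin a) ℂ) ⊗ₖ M j) *ᵥ ((A ⊗ₖ B) *ᵥ φ l) =
        (A ⊗ₖ (M j * B)) *ᵥ φ l := by
      intro j l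
      rw [Matrix.mulVec_mulVec, ← Matrix.mul_kronecker_mul, Matrix.one_mul]
    have hw : ∀ j, ∃ w : I → ℝ, ∀ i l,
        (next j).weight i ((A ⊗ₖ (M j * B)) *ᵥ φ l) = w i * sqNorm (φ l) := by
      intro j
      have hbr := hI.bob_branch hnx j
      simp only [hmul] at hbr
      obtain ⟨β', hβ'⟩ := hB _ _ A (M j * B) α (left_ne_zero_of_mul h0) hα
        fun i l hil => hbr.orthogonal hil
      exact ih j (fun N => nx N j) (fun N => hcont N j) _ _ α β' hα hβ' hbr
    choose w hw using hw
    refine ⟨fun i => ∑ j, w j i, fun i l => ?_⟩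
    simp only [weight, hmul, hw, Finset.sum_mul]

end LOCCProtocol

open LOCCProtocol in
theorem not_LOCCDistinguishable_of_rigid {I : Type} [Nontrivial I] {a b : ℕ}
    {φ : I → BipartiteVector a b} (h0 : ∀ i, φ i ≠ 0) (hA : AliceRigid φ) (hB : BobRigid φ) :
    ¬ LOCCDistinguishable φ := by
  classical
  rintro ⟨P, hP, hlim⟩
  have hpos : ∀ i, 0 < sqNorm (φ i) := fun i => sqNorm_pos (h0 i)
  have hI : Identifies P φ := by
    intro i
    have := (hlim i).mul_const (sqNorm (φ i))
    simpa only [prob, div_mul_cancel₀ _ (hpos i).ne', one_mul] using this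
  have hcont : ∀ N M, (P N).ContinuedBy (P (M + N)) := by
    intro N M
    induction M with
    | zero => rw [zero_add]; exact ContinuedBy.refl _
    | succ M ih => rw [Nat.succ_add]; exact ih.trans (hP _)
  have hw : ∀ N, ∃ w : I → ℝ, ∀ i l, (P N).weight i (φ l) = w i * sqNorm (φ l) := by
    intro N
    -- The shifted sequence is used because only the parts from `N` on continue `P N`.
    have h := exists_weight_eq_mul_sqNorm hA hB (P N) (fun M => P (M + N)) (hcont N) 1 1 1 1
      (by simp) (by simp) (by
        intro i
        simp only [Matrix.one_kronecker_one, Matrix.one_mulVec]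
        exact (hI i).comp (Filter.tendsto_add_atTop_nat N))
    simpa only [Matrix.one_kronecker_one, Matrix.one_mulVec] using h
  choose w hw using hw
  obtain ⟨i, j, hij⟩ := exists_pair_ne I
  have hwlim : ∀ i, Filter.Tendsto (fun N => w N i) Filter.atTop (𝓝 1) := by
    intro i
    simpa only [prob, hw, mul_div_cancel_right₀ _ (hpos i).ne'] using hlim i
  -- Run on the single state `φ i`, the answers `i` and `j` exclude each other; both probabilities
  -- are nevertheless state-independent.
  have hle : ∀ N, w N i + w N j ≤ 1 := by
    intro N
    have := (P N).sum_weight_le {i, j} (φ i)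
    rw [Finset.sum_pair hij, hw, hw, ← add_mul] at this
    exact le_of_mul_le_mul_right (this.trans_eq (one_mul _).symm) (hpos i)
  have := le_of_tendsto' ((hwlim i).add (hwlim j)) hle
  norm_num at this


/-! ### The strips -/

theorem omega_isPrimitiveRoot : IsPrimitiveRoot omega 3 := by
  have := Complex.isPrimitiveRoot_exp 3 (by norm_num)
  simpa [omega] using this

theorem omega_sq : omega ^ 2 = -1 - omega := by
  have h := omega_isPrimitiveRoot.geom_sum_eq_zero (by norm_num)
  simp only [Finset.sum_range_succ, Finset.sum_range_zero, pow_zero, pow_one] at h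
  linear_combination h

theorem star_omega : star omega = -1 - omega := by
  have h3 : omega ^ 3 = 1 := omega_isPrimitiveRoot.pow_eq_one
  have hn : ‖omega‖ = 1 := omega_isPrimitiveRoot.norm'_eq_one (by norm_num)
  have h1 : star omega * omega = 1 := by
    rw [Complex.star_def, Complex.conj_mul', hn]; norm_num
  rw [← omega_sq]
  linear_combination omega ^ 2 * h1 - star omega * h3

theorem star_ket (N k : ℕ) : star (ket N k) = ket N k := by
  ext i
  simp only [ket, Pi.star_apply]
  split_ifs <;> simp

theorem ket_dotProduct {N k : ℕ} (hk : k < N) (x : Fin N → ℂ) : ket N k ⬝ᵥ x = x ⟨k, hk⟩ := by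
  rw [dotProduct, Finset.sum_eq_single ⟨k, hk⟩]
  · simp [ket]
  · intro i _ hi
    have : (i : ℕ) ≠ k := fun h => hi (Fin.ext h)
    simp [ket, this]
  · simp

/-- The matrix entry `⟨p|E|q⟩`, which is zero out of range. -/
def ketEntry {N : ℕ} (E : Matrix (Fin N) (Fin N) ℂ) (p q : ℕ) : ℂ := ket N p ⬝ᵥ (E *ᵥ ket N q)

theorem ketEntry_eq {N : ℕ} (E : Matrix (Fin N) (Fin N) ℂ) (i j : Fin N) :
    ketEntry E i j = E i j := by
  rw [ketEntry, ket_dotProduct i.2, Matrix.mulVec, dotProduct_comm, ket_dotProduct j.2]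

theorem ketEntry_one {N p q : ℕ} (hp : p < N) (hq : q < N) :
    ketEntry (1 : Matrix (Fin N) (Fin N) ℂ) p q = if p = q then 1 else 0 := by
  rw [← Fin.val_mk hp, ← Fin.val_mk hq, ketEntry_eq, Matrix.one_apply]
  simp [Fin.ext_iff]

/-- The block of a strip that a label belongs to: the block of three, or a pair. -/
def stripBlock {d : ℕ} : StripLabel d → ℕ
  | Sum.inl _ => 0
  | Sum.inr (δ, _) => (δ : ℕ) + 1

/-- The block of a strip that contains the `k`-th position. -/
def positionBlock (k : ℕ) : ℕ := if k < 3 then 0 else (k - 1) / 2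

theorem ket_mem_span_stripVector (N s : ℕ) {d k : ℕ} (hk : k < 2 * d - 1) (hd : 2 ≤ d) :
    ket N (k + s) ∈ Submodule.span ℂ
      (stripVector N s '' {l : StripLabel d | stripBlock l = positionBlock k}) := by
  have hc := omega_sq
  by_cases h3 : k < 3
  -- Inverse discrete Fourier transform on three points, with `ω^(2tk) = ω^(-tk)`.
  · have h : ket N (k + s) = ∑ t : Fin 3, ((1 / 3 : ℂ) * omega ^ (2 * (t : ℕ) * k)) •
        stripVector N s (Sum.inl t : StripLabel d) := by
      ext i
      have h4 : omega ^ 4 = omega := by grind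
      have h8 : omega ^ 8 = -1 - omega := by grind
      interval_cases k <;>
      · simp [Fin.sum_univ_three, stripVector, hc, h4, h8]
        grind
    rw [h]
    refine Submodule.sum_mem _ fun t _ => Submodule.smul_mem _ _ (Submodule.subset_span ⟨_, ?_, rfl⟩)
    simp [stripBlock, positionBlock, h3]
  · obtain ⟨δ, hδ⟩ : ∃ δ : Fin (d - 2), k = 2 * δ + 3 ∨ k = 2 * δ + 4 :=
      ⟨⟨(k - 3) / 2, by omega⟩, by simp only; omega⟩
    have hmem : ∀ b, stripVector N s (Sum.inr (δ, b)) ∈ Submodule.span ℂ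
        (stripVector N s '' {l : StripLabel d | stripBlock l = positionBlock k}) := by
      refine fun b => Submodule.subset_span ⟨_, ?_, rfl⟩
      simp only [stripBlock, positionBlock, Set.mem_ofPred_eq, if_neg h3]
      omega
    rcases hδ with rfl | rfl
    · have h : ket N (2 * (δ : ℕ) + 3 + s) =
          (1 / 2 : ℂ) • (stripVector N s (Sum.inr (δ, true)) +
            stripVector N s (Sum.inr (δ, false))) := by
        ext i
        simp [stripVector]
        ring
      rw [h]
      exact Submodule.smul_mem _ _ (Submodule.add_mem _ (hmem _) (hmem _))
    · have h : ket N (2 * (δ : ℕ) + 4 + s) =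
          (1 / 2 : ℂ) • (stripVector N s (Sum.inr (δ, true)) -
            stripVector N s (Sum.inr (δ, false))) := by
        ext i
        simp [stripVector]
        ring
      rw [h]
      exact Submodule.smul_mem _ _ (Submodule.sub_mem _ (hmem _) (hmem _))

theorem mulVec_dotProduct_eq_zero_of_mem_span {N : ℕ} {E : Matrix (Fin N) (Fin N) ℂ}
    {S T : Set (Fin N → ℂ)} (h : ∀ x ∈ S, ∀ y ∈ T, star x ⬝ᵥ (E *ᵥ y) = 0) {x y : Fin N → ℂ}
    (hx : x ∈ Submodule.span ℂ S) (hy : y ∈ Submodule.span ℂ T) : star x ⬝ᵥ (E *ᵥ y) = 0 := by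
  induction hx using Submodule.span_induction with
  | zero => simp
  | add u v _ _ hu hv => rw [star_add, add_dotProduct, hu, hv, add_zero]
  | smul a u _ hu => rw [star_smul, smul_dotProduct, hu, smul_zero]
  | mem x hx =>
    induction hy using Submodule.span_induction with
    | zero => simp
    | add u v _ _ hu hv => rw [Matrix.mulVec_add, dotProduct_add, hu, hv, add_zero]
    | smul a u _ hu => rw [Matrix.mulVec_smul, dotProduct_smul, hu, smul_zero]
    | mem y hy => exact h x hx y hy

/-- `E` is diagonal with respect to the vectors of the strip that starts at `s`. -/
def StripDiagonal {N : ℕ} (d s : ℕ) (E : Matrix (Fin N) (Fin N) ℂ) : Prop :=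
  ∀ l k : StripLabel d, l ≠ k → star (stripVector N s l) ⬝ᵥ (E *ᵥ stripVector N s k) = 0

/-- Each ket of a strip is a combination of the strip vectors of its own block, and vectors of
different blocks have different labels. -/
theorem StripDiagonal.ketEntry_eq_zero {N d s p q : ℕ} {E : Matrix (Fin N) (Fin N) ℂ}
    (h : StripDiagonal d s E) (hd : 2 ≤ d) (hp : p < 2 * d - 1) (hq : q < 2 * d - 1)
    (hpq : positionBlock p ≠ positionBlock q) : ketEntry E (p + s) (q + s) = 0 := by
  rw [ketEntry, ← star_ket]
  refine mulVec_dotProduct_eq_zero_of_mem_span ?_ (ket_mem_span_stripVector N s hp hd)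
    (ket_mem_span_stripVector N s hq hd)
  rintro _ ⟨l, hl, rfl⟩ _ ⟨k, hk, rfl⟩
  refine h l k ?_
  rintro rfl
  exact hpq (hl.symm.trans hk)

theorem star_stripVector_dotProduct_inl {N d s : ℕ} (E : Matrix (Fin N) (Fin N) ℂ) (t t' : Fin 3) :
    star (stripVector N s (Sum.inl t : StripLabel d)) ⬝ᵥ
      (E *ᵥ stripVector N s (Sum.inl t' : StripLabel d)) =
    ∑ j : Fin 3, ∑ j' : Fin 3, star omega ^ ((t : ℕ) * (j : ℕ)) * omega ^ ((t' : ℕ) * (j' : ℕ)) *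
      ketEntry E (j + s) (j' + s) := by
  simp only [stripVector, star_sum, star_smul, star_ket, Matrix.mulVec_sum, Matrix.mulVec_smul,
    sum_dotProduct, dotProduct_sum, smul_dotProduct, dotProduct_smul, star_pow, smul_eq_mul,
    ketEntry, mul_assoc, Finset.mul_sum]
  rw [Finset.sum_comm]
  exact Finset.sum_congr rfl fun _ _ => Finset.sum_congr rfl fun _ _ => by ring

/-- A 3×3 block that is diagonal in the Fourier basis is circulant; listed are the equalities used
for the diagonal and for the entries between |1⟩ and |2⟩. -/
theorem StripDiagonal.triple {N d s : ℕ} {E : Matrix (Fin N) (Fin N) ℂ}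
    (h : StripDiagonal d s E) :
    ketEntry E (1 + s) (1 + s) = ketEntry E s s ∧ ketEntry E (2 + s) (2 + s) = ketEntry E s s ∧
    ketEntry E (1 + s) (2 + s) = ketEntry E s (1 + s) ∧
    ketEntry E (2 + s) (1 + s) = ketEntry E (1 + s) s := by
  have hc := omega_sq
  have h4 : omega ^ 4 = omega := by grind
  have hs2 : (-1 - omega) ^ 2 = omega := by grind
  have hs4 : (-1 - omega) ^ 4 = -1 - omega := by grind
  have H : ∀ t t' : Fin 3, t ≠ t' → _ := fun t t' ht =>
    (star_stripVector_dotProduct_inl (d := d) (s := s) E t t').symm.trans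
      (h (Sum.inl t) (Sum.inl t') (by simpa using ht))
  simp only [star_omega, Fin.sum_univ_three] at H
  have h01 := H 0 1 (by decide)
  have h02 := H 0 2 (by decide)
  have h10 := H 1 0 (by decide)
  have h12 := H 1 2 (by decide)
  have h20 := H 2 0 (by decide)
  have h21 := H 2 1 (by decide)
  simp [hc, h4, hs2, hs4] at h01 h02 h10 h12 h20 h21
  refine ⟨?_, ?_, ?_, ?_⟩ <;> grind

theorem StripDiagonal.pair {N d s : ℕ} {E : Matrix (Fin N) (Fin N) ℂ}
    (h : StripDiagonal d s E) (δ : Fin (d - 2)) :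
    ketEntry E (2 * δ + 4 + s) (2 * δ + 4 + s) = ketEntry E (2 * δ + 3 + s) (2 * δ + 3 + s) := by
  have h1 := h (Sum.inr (δ, true)) (Sum.inr (δ, false)) (by simp)
  have h2 := h (Sum.inr (δ, false)) (Sum.inr (δ, true)) (by simp)
  simp only [stripVector, star_add, star_sub, star_ket, Matrix.mulVec_add, Matrix.mulVec_sub,
    add_dotProduct, sub_dotProduct, dotProduct_add, dotProduct_sub] at h1 h2
  -- For kets `u`, `v`, adding the conditions for `(u+v, u-v)` and `(u-v, u+v)` cancels the cross
  -- terms and leaves `2 (E_uu - E_vv)`.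
  simp only [ketEntry]
  linear_combination (-1 / 2 : ℂ) * h1 - (1 / 2 : ℂ) * h2

/-- A matrix that is diagonal with respect to both strips, with no entries that connect `|0⟩` to the
second strip or `|N-1⟩` to the first, is scalar. -/
theorem StripDiagonal.eq_smul_one {N d : ℕ} (hN : N = 2 * d) (hd : 2 ≤ d)
    {E : Matrix (Fin N) (Fin N) ℂ} (h0 : StripDiagonal d 0 E) (h1 : StripDiagonal d 1 E)
    (hl : ∀ k : StripLabel d, star (ket N 0) ⬝ᵥ (E *ᵥ stripVector N 1 k) = 0)
    (hl' : ∀ k : StripLabel d, star (stripVector N 1 k) ⬝ᵥ (E *ᵥ ket N 0) = 0)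
    (hr : ∀ k : StripLabel d, star (ket N (N - 1)) ⬝ᵥ (E *ᵥ stripVector N 0 k) = 0)
    (hr' : ∀ k : StripLabel d, star (stripVector N 0 k) ⬝ᵥ (E *ᵥ ket N (N - 1)) = 0) :
    ∃ c : ℂ, E = c • 1 := by
  have spanned : ∀ s k, k < 2 * d - 1 → ket N (k + s) ∈
      Submodule.span ℂ (Set.range (stripVector N s : StripLabel d → _)) := fun s k hk =>
    Submodule.span_mono (Set.image_subset_range _ _) (ket_mem_span_stripVector N s hk hd)
  have e0 : ∀ p, 0 < p → p < N → ketEntry E 0 p = 0 ∧ ketEntry E p 0 = 0 := by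
    intro p hp hpN
    obtain ⟨k, rfl⟩ : ∃ k, p = k + 1 := ⟨p - 1, by omega⟩
    have hm := spanned 1 k (by omega)
    have hz := Submodule.subset_span (R := ℂ) (Set.mem_singleton (ket N 0))
    constructor <;> rw [ketEntry, ← star_ket]
    · refine mulVec_dotProduct_eq_zero_of_mem_span ?_ hz hm
      rintro _ rfl _ ⟨l, rfl⟩
      exact hl l
    · refine mulVec_dotProduct_eq_zero_of_mem_span ?_ hm hz
      rintro _ ⟨l, rfl⟩ _ rfl
      exact hl' l
  have eN : ∀ p, p < N - 1 → ketEntry E (N - 1) p = 0 ∧ ketEntry E p (N - 1) = 0 := by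
    intro p hpN
    have hm := spanned 0 p (by omega)
    have hz := Submodule.subset_span (R := ℂ) (Set.mem_singleton (ket N (N - 1)))
    constructor <;> rw [ketEntry, ← star_ket]
    · refine mulVec_dotProduct_eq_zero_of_mem_span ?_ hz hm
      rintro _ rfl _ ⟨l, rfl⟩
      exact hr l
    · refine mulVec_dotProduct_eq_zero_of_mem_span ?_ hm hz
      rintro _ ⟨l, rfl⟩ _ rfl
      exact hr' l
  obtain ⟨t1, t2, t3, t4⟩ := h0.triple
  simp only [add_zero] at t1 t2 t3 t4
  have hoff : ∀ p q, p < N → q < N → p ≠ q → ketEntry E p q = 0 := by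
    intro p q hp hq hpq
    by_cases p0 : p = 0
    · subst p0; exact (e0 q (by omega) hq).1
    by_cases q0 : q = 0
    · subst q0; exact (e0 p (by omega) hp).2
    by_cases pN : p = N - 1
    · subst pN; exact (eN q (by omega)).1
    by_cases qN : q = N - 1
    · subst qN; exact (eN p (by omega)).2
    by_cases hb : positionBlock p = positionBlock q
    · by_cases hb' : positionBlock (p - 1) = positionBlock (q - 1)
      -- Away from the ends, |1⟩ and |2⟩ are the only two positions sharing a block in both strips.
      · have : p = 1 ∧ q = 2 ∨ p = 2 ∧ q = 1 := by
          simp only [positionBlock] at hb hb'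
          split_ifs at hb hb' <;> omega
        rcases this with ⟨rfl, rfl⟩ | ⟨rfl, rfl⟩
        · rw [t3]; exact (e0 1 (by omega) (by omega)).1
        · rw [t4]; exact (e0 1 (by omega) (by omega)).2
      · have := h1.ketEntry_eq_zero hd (p := p - 1) (q := q - 1) (by omega) (by omega) hb'
        rwa [Nat.sub_add_cancel (by omega), Nat.sub_add_cancel (by omega)] at this
    · exact h0.ketEntry_eq_zero hd (by omega) (by omega) hb
  have hdiag : ∀ p, p < N → ketEntry E p p = ketEntry E 0 0 := by
    intro p
    induction p with
    | zero => exact fun _ => rfl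
    | succ p ih =>
      intro hp
      rw [← ih (by omega)]
      by_cases hp2 : p < 2
      · interval_cases p
        · exact t1
        · exact t2.trans t1.symm
      by_cases hp3 : p = 2
      · subst hp3
        obtain ⟨u1, u2, -⟩ := h1.triple
        exact u2.trans u1.symm
      -- From 3 on, the first strip pairs odd `p` with `p + 1` and the second pairs even `p` with `p
      -- + 1`.
      rcases Nat.even_or_odd' p with ⟨r, rfl | rfl⟩
      · have := h1.pair ⟨r - 2, by omega⟩
        simp only at this
        convert this using 2 <;> omega
      · have := h0.pair ⟨r - 1, by omega⟩
        simp only at this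
        convert this using 2 <;> omega
  refine ⟨ketEntry E 0 0, ?_⟩
  ext i j
  rw [← ketEntry_eq E, Matrix.smul_apply, Matrix.one_apply]
  split_ifs with hij
  · subst hij; rw [hdiag i i.2, smul_eq_mul, mul_one]
  · rw [hoff i j i.2 j.2 (fun h => hij (Fin.ext h)), smul_zero]


/-! ### Supports, non-vanishing and orthogonality of strip vectors. -/

theorem stripVector_support {N s d : ℕ} (l : StripLabel d) (hd : 2 ≤ d) {i : Fin N}
    (h : stripVector N s l i ≠ 0) :
    s ≤ i ∧ (i : ℕ) < 2 * d - 1 + s ∧ positionBlock (i - s) = stripBlock l := by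
  contrapose! h
  rcases l with t | ⟨δ, b⟩
  · simp only [stripVector, Finset.sum_apply, Pi.smul_apply, smul_eq_mul]
    refine Finset.sum_eq_zero fun j _ => ?_
    have hj := j.2
    have : (i : ℕ) ≠ j + s := by
      intro hi
      refine h (by omega) (by omega) ?_
      simp only [positionBlock, stripBlock]
      split_ifs <;> omega
    simp [ket, this]
  · have hδ := δ.2
    have h1 : (i : ℕ) ≠ 2 * δ + 3 + s := by
      intro hi
      refine h (by omega) (by omega) ?_
      simp only [positionBlock, stripBlock]
      split_ifs <;> omega
    have h2 : (i : ℕ) ≠ 2 * δ + 4 + s := by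
      intro hi
      refine h (by omega) (by omega) ?_
      simp only [positionBlock, stripBlock]
      split_ifs <;> omega
    cases b <;> simp [stripVector, ket, h1, h2]

theorem stripVector_ne_zero {N s d : ℕ} (l : StripLabel d) (hd : 2 ≤ d) (hN : 2 * d - 1 + s ≤ N) :
    stripVector N s l ≠ 0 := by
  rcases l with t | ⟨δ, b⟩
  · refine Function.ne_iff.2 ⟨⟨s, by omega⟩, ?_⟩
    simp [stripVector, ket]
  · have hδ := δ.2
    refine Function.ne_iff.2 ⟨⟨2 * δ + 3 + s, by omega⟩, ?_⟩
    cases b <;> simp [stripVector, ket]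

/-- Otherwise the ket, which lies in the span of strip vectors, would be killed by its own
coordinate functional. -/
theorem exists_stripVector_apply_ne_zero {N s d k : ℕ} (hd : 2 ≤ d) (hk : k < 2 * d - 1)
    (hN : k + s < N) : ∃ l : StripLabel d, stripVector N s l ⟨k + s, hN⟩ ≠ 0 := by
  by_contra! h
  have hle : Submodule.span ℂ
      (stripVector N s '' {l : StripLabel d | stripBlock l = positionBlock k}) ≤
      LinearMap.ker (LinearMap.proj (R := ℂ) (φ := fun _ : Fin N => ℂ) ⟨k + s, hN⟩) := by
    rw [Submodule.span_le]
    rintro _ ⟨l, -, rfl⟩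
    exact h l
  have := hle (ket_mem_span_stripVector N s hk hd)
  simp [ket] at this

theorem ket_dotProduct_self {N k : ℕ} (hk : k < N) : ket N k ⬝ᵥ ket N k = 1 := by
  rw [ket_dotProduct hk]; simp [ket]

theorem ket_dotProduct_ket_of_ne {N p q : ℕ} (h : p ≠ q) : ket N p ⬝ᵥ ket N q = 0 := by
  refine Finset.sum_eq_zero fun i _ => ?_
  simp only [ket]
  split_ifs <;> simp_all

/-- Different blocks have disjoint supports; inside the triple `1 + ω + ω² = 0`, and inside a pair
the two contributions cancel. -/
theorem stripDiagonal_one {N s d : ℕ} (hd : 2 ≤ d) (hN : 2 * d - 1 + s ≤ N) :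
    StripDiagonal d s (1 : Matrix (Fin N) (Fin N) ℂ) := by
  intro l k hlk
  by_cases hb : stripBlock l = stripBlock k
  · rcases l with t | ⟨δ, b⟩ <;> rcases k with t' | ⟨δ', b'⟩
    · rw [star_stripVector_dotProduct_inl]
      have hc := omega_sq
      have h4 : omega ^ 4 = omega := by grind
      have hs2 : (-1 - omega) ^ 2 = omega := by grind
      have hs4 : (-1 - omega) ^ 4 = -1 - omega := by grind
      have hlk' : t ≠ t' := by simpa using hlk
      have hE : ∀ j j' : Fin 3, ketEntry (1 : Matrix (Fin N) (Fin N) ℂ) (j + s) (j' + s) =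
          if j = j' then 1 else 0 := by
        intro j j'
        rw [ketEntry_one (by omega) (by omega)]
        simp [Fin.ext_iff]
      simp only [hE, star_omega, mul_ite, mul_one, mul_zero, Finset.sum_ite_eq, Finset.mem_univ,
        if_true, Fin.sum_univ_three]
      fin_cases t <;> fin_cases t' <;> simp [hc, h4, hs2, hs4] at hlk' ⊢ <;> grind
    · simp [stripBlock] at hb
    · simp [stripBlock] at hb
    · obtain rfl : δ = δ' := Fin.ext (by simpa [stripBlock] using hb)
      have hδ := δ.2
      have hne : 2 * (δ : ℕ) + 3 + s ≠ 2 * (δ : ℕ) + 4 + s := by omega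
      have h3 := ket_dotProduct_self (N := N) (k := 2 * (δ : ℕ) + 3 + s) (by omega)
      have h4 := ket_dotProduct_self (N := N) (k := 2 * (δ : ℕ) + 4 + s) (by omega)
      cases b <;> cases b' <;>
        simp [stripVector, star_ket, add_dotProduct, sub_dotProduct, h3, h4,
          ket_dotProduct_ket_of_ne hne, ket_dotProduct_ket_of_ne hne.symm] at hlk ⊢
  · rw [Matrix.one_mulVec]
    refine Finset.sum_eq_zero fun i _ => ?_
    by_contra hne
    have h1 := stripVector_support l hd (star_ne_zero.1 (left_ne_zero_of_mul hne))
    have h2 := stripVector_support k hd (right_ne_zero_of_mul hne)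
    exact hb (h1.2.2.symm.trans h2.2.2)

theorem star_stripVector_dotProduct_ket {N s d k : ℕ} (hk : k < N) (l : StripLabel d) :
    star (stripVector N s l) ⬝ᵥ ket N k = star (stripVector N s l ⟨k, hk⟩) := by
  rw [dotProduct_comm, ket_dotProduct hk, Pi.star_apply]

/-! ### Product vectors -/

theorem kronecker_mulVec_productVector {a b a' b' : ℕ} (A : Matrix (Fin a') (Fin a) ℂ)
    (B : Matrix (Fin b') (Fin b) ℂ) (u : Fin a → ℂ) (v : Fin b → ℂ) :
    (A ⊗ₖ B) *ᵥ productVector u v = productVector (A *ᵥ u) (B *ᵥ v) := by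
  ext ⟨i, j⟩
  simp only [Matrix.mulVec, dotProduct, productVector, Matrix.kronecker_apply,
    Finset.sum_mul_sum, Fintype.sum_prod_type]
  exact Finset.sum_congr rfl fun _ _ => Finset.sum_congr rfl fun _ _ => by ring

theorem star_productVector_dotProduct {a b : ℕ} (u u' : Fin a → ℂ) (v v' : Fin b → ℂ) :
    star (productVector u v) ⬝ᵥ productVector u' v' = (star u ⬝ᵥ u') * (star v ⬝ᵥ v') := by
  simp only [dotProduct, productVector, Pi.star_apply, Finset.sum_mul_sum, Fintype.sum_prod_type,
    star_mul']
  exact Finset.sum_congr rfl fun _ _ => Finset.sum_congr rfl fun _ _ => by ring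

theorem star_kronecker_mulVec_productVector_dotProduct {a b a' b' : ℕ}
    (A : Matrix (Fin a') (Fin a) ℂ) (B : Matrix (Fin b') (Fin b) ℂ) (u u' : Fin a → ℂ)
    (v v' : Fin b → ℂ) :
    star ((A ⊗ₖ B) *ᵥ productVector u v) ⬝ᵥ ((A ⊗ₖ B) *ᵥ productVector u' v') =
      (star u ⬝ᵥ ((Aᴴ * A) *ᵥ u')) * (star v ⬝ᵥ ((Bᴴ * B) *ᵥ v')) := by
  rw [kronecker_mulVec_productVector, kronecker_mulVec_productVector,
    star_productVector_dotProduct, star_mulVec_dotProduct_mulVec, star_mulVec_dotProduct_mulVec]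

theorem productVector_ne_zero {a b : ℕ} {u : Fin a → ℂ} {v : Fin b → ℂ} (hu : u ≠ 0)
    (hv : v ≠ 0) : productVector u v ≠ 0 := by
  obtain ⟨i, hi⟩ := Function.ne_iff.1 hu
  obtain ⟨j, hj⟩ := Function.ne_iff.1 hv
  exact Function.ne_iff.2 ⟨(i, j), mul_ne_zero hi hj⟩

theorem ket_ne_zero {N k : ℕ} (hk : k < N) : ket N k ≠ 0 :=
  Function.ne_iff.2 ⟨⟨k, hk⟩, by simp [ket]⟩

/-! ### The states -/

theorem boundaryState_ne_zero {d₁ d₂ : ℕ} (h₁ : 2 ≤ d₁) (h₂ : 2 ≤ d₂) (i : StateLabel d₁ d₂) :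
    boundaryState d₁ d₂ (2 * d₁) (2 * d₂) i ≠ 0 := by
  cases i with
  | top l =>
    exact productVector_ne_zero (ket_ne_zero (by omega)) (stripVector_ne_zero l h₂ (by omega))
  | right l =>
    exact productVector_ne_zero (stripVector_ne_zero l h₁ (by omega)) (ket_ne_zero (by omega))
  | bottom l =>
    exact productVector_ne_zero (ket_ne_zero (by omega)) (stripVector_ne_zero l h₂ (by omega))
  | left l =>
    exact productVector_ne_zero (stripVector_ne_zero l h₁ (by omega)) (ket_ne_zero (by omega))

theorem star_stripVector_zero_dotProduct_ket_last {d : ℕ} (hd : 2 ≤ d) (l : StripLabel d) :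
    star (stripVector (2 * d) 0 l) ⬝ᵥ ket (2 * d) (2 * d - 1) = 0 := by
  rw [star_stripVector_dotProduct_ket (by omega), star_eq_zero]
  by_contra h
  have := (stripVector_support l hd h).2.1
  simp only at this
  omega

theorem star_stripVector_one_dotProduct_ket_zero {d : ℕ} (hd : 2 ≤ d) (l : StripLabel d) :
    star (stripVector (2 * d) 1 l) ⬝ᵥ ket (2 * d) 0 = 0 := by
  rw [star_stripVector_dotProduct_ket (by omega), star_eq_zero]
  by_contra h
  have := (stripVector_support l hd h).1
  simp only at this
  omega

theorem star_dotProduct_eq_zero_comm {ι : Type*} [Fintype ι] {x y : ι → ℂ} :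
    star x ⬝ᵥ y = 0 ↔ star y ⬝ᵥ x = 0 := by
  rw [← star_eq_zero, ← Matrix.star_dotProduct_star, star_star, dotProduct_comm]

/-- The strips form a pinwheel: each omits one end corner of its side, so different strips have
disjoint supports. -/
theorem boundaryState_orthogonal {d₁ d₂ : ℕ} (h₁ : 2 ≤ d₁) (h₂ : 2 ≤ d₂) {i j : StateLabel d₁ d₂}
    (hij : i ≠ j) :
    star (boundaryState d₁ d₂ (2 * d₁) (2 * d₂) i) ⬝ᵥ
      boundaryState d₁ d₂ (2 * d₁) (2 * d₂) j = 0 := by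
  have hs : ∀ {d s : ℕ}, 2 ≤ d → s ≤ 1 → ∀ l k : StripLabel d, l ≠ k →
      star (stripVector (2 * d) s l) ⬝ᵥ stripVector (2 * d) s k = 0 := by
    intro d s hd hs1 l k hlk
    simpa using stripDiagonal_one (N := 2 * d) hd (by omega) l k hlk
  have hk : ∀ {d : ℕ}, 2 ≤ d → star (ket (2 * d) 0) ⬝ᵥ ket (2 * d) (2 * d - 1) = 0 := by
    intro d hd
    rw [star_ket, ket_dotProduct_ket_of_ne (by omega)]
  cases i <;> cases j <;> simp only [boundaryState, star_productVector_dotProduct, mul_eq_zero] <;>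
    simp only [ne_eq, StateLabel.top.injEq, StateLabel.right.injEq, StateLabel.bottom.injEq,
      StateLabel.left.injEq] at hij
  · exact .inr (hs h₂ (by omega) _ _ hij)
  · exact .inr (star_stripVector_zero_dotProduct_ket_last h₂ _)
  · exact .inl (hk h₁)
  · exact .inl (star_dotProduct_eq_zero_comm.1 (star_stripVector_one_dotProduct_ket_zero h₁ _))
  · exact .inr (star_dotProduct_eq_zero_comm.1 (star_stripVector_zero_dotProduct_ket_last h₂ _))
  · exact .inl (hs h₁ (by omega) _ _ hij)
  · exact .inl (star_stripVector_zero_dotProduct_ket_last h₁ _)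
  · exact .inr (star_dotProduct_eq_zero_comm.1 (hk h₂))
  · exact .inl (star_dotProduct_eq_zero_comm.1 (hk h₁))
  · exact .inl (star_dotProduct_eq_zero_comm.1 (star_stripVector_zero_dotProduct_ket_last h₁ _))
  · exact .inr (hs h₂ (by omega) _ _ hij)
  · exact .inr (star_stripVector_one_dotProduct_ket_zero h₂ _)
  · exact .inl (star_stripVector_one_dotProduct_ket_zero h₁ _)
  · exact .inr (hk h₂)
  · exact .inr (star_dotProduct_eq_zero_comm.1 (star_stripVector_one_dotProduct_ket_zero h₂ _))
  · exact .inl (hs h₁ (by omega) _ _ hij)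

/-- Provides a state of one strip that overlaps the neighbouring strip on one side, so that their
orthogonality must come from the other party. -/
theorem exists_star_stripVector_zero_dotProduct_ket_ne_zero {d : ℕ} (hd : 2 ≤ d) :
    ∃ l : StripLabel d, star (stripVector (2 * d) 0 l) ⬝ᵥ ket (2 * d) 0 ≠ 0 ∧
      star (ket (2 * d) 0) ⬝ᵥ stripVector (2 * d) 0 l ≠ 0 := by
  obtain ⟨l, hl⟩ := exists_stripVector_apply_ne_zero (N := 2 * d) (s := 0) (k := 0) hd
    (by omega) (by omega)
  have h : star (stripVector (2 * d) 0 l) ⬝ᵥ ket (2 * d) 0 ≠ 0 := by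
    rw [star_stripVector_dotProduct_ket (by omega)]
    exact star_ne_zero.2 hl
  exact ⟨l, h, fun h' => h (star_dotProduct_eq_zero_comm.1 h')⟩

theorem exists_star_stripVector_one_dotProduct_ket_ne_zero {d : ℕ} (hd : 2 ≤ d) :
    ∃ l : StripLabel d, star (stripVector (2 * d) 1 l) ⬝ᵥ ket (2 * d) (2 * d - 1) ≠ 0 ∧
      star (ket (2 * d) (2 * d - 1)) ⬝ᵥ stripVector (2 * d) 1 l ≠ 0 := by
  -- Position `2d - 2` of the strip shifted by 1 is the last ket.
  obtain ⟨l, hl⟩ := exists_stripVector_apply_ne_zero (N := 2 * d) (s := 1) (k := 2 * d - 2) hd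
    (by omega) (by omega)
  have h : star (stripVector (2 * d) 1 l) ⬝ᵥ ket (2 * d) (2 * d - 1) ≠ 0 := by
    rw [star_stripVector_dotProduct_ket (by omega)]
    convert star_ne_zero.2 hl using 4
    omega
  exact ⟨l, h, fun h' => h (star_dotProduct_eq_zero_comm.1 h')⟩

theorem star_ket_dotProduct_self_ne_zero {N k : ℕ} (hk : k < N) :
    star (ket N k) ⬝ᵥ ket N k ≠ 0 := by
  rw [star_ket, ket_dotProduct_self hk]
  exact one_ne_zero

theorem aliceRigid_boundaryState {d₁ d₂ : ℕ} (h₁ : 2 ≤ d₁) (h₂ : 2 ≤ d₂) :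
    AliceRigid (boundaryState d₁ d₂ (2 * d₁) (2 * d₂)) := by
  intro a b A B β hβ0 hβ h
  have key : ∀ {u u' : Fin (2 * d₁) → ℂ} {v v' : Fin (2 * d₂) → ℂ}, star v ⬝ᵥ v' ≠ 0 →
      star ((A ⊗ₖ B) *ᵥ productVector u v) ⬝ᵥ ((A ⊗ₖ B) *ᵥ productVector u' v') = 0 →
      star u ⬝ᵥ ((Aᴴ * A) *ᵥ u') = 0 := by
    intro u u' v v' hv h0
    rw [star_kronecker_mulVec_productVector_dotProduct, hβ, Matrix.smul_mulVec, Matrix.one_mulVec,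
      dotProduct_smul, smul_eq_mul] at h0
    exact (mul_eq_zero.1 h0).resolve_right (mul_ne_zero hβ0 hv)
  obtain ⟨t, ht, ht'⟩ := exists_star_stripVector_zero_dotProduct_ket_ne_zero h₂
  obtain ⟨r, hr, hr'⟩ := exists_star_stripVector_one_dotProduct_ket_ne_zero h₂
  refine StripDiagonal.eq_smul_one rfl h₁ (fun l k hlk => ?_) (fun l k hlk => ?_)
    (fun k => ?_) (fun k => ?_) (fun k => ?_) (fun k => ?_)
  · exact key (star_ket_dotProduct_self_ne_zero (by omega)) (h (.right l) (.right k) (by simpa))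
  · exact key (star_ket_dotProduct_self_ne_zero (by omega)) (h (.left l) (.left k) (by simpa))
  · exact key ht (h (.top t) (.left k) (by simp))
  · exact key ht' (h (.left k) (.top t) (by simp))
  · exact key hr (h (.bottom r) (.right k) (by simp))
  · exact key hr' (h (.right k) (.bottom r) (by simp))

theorem bobRigid_boundaryState {d₁ d₂ : ℕ} (h₁ : 2 ≤ d₁) (h₂ : 2 ≤ d₂) :
    BobRigid (boundaryState d₁ d₂ (2 * d₁) (2 * d₂)) := by
  intro a b A B α hα0 hα h
  have key : ∀ {u u' : Fin (2 * d₁) → ℂ} {v v' : Fin (2 * d₂) → ℂ}, star u ⬝ᵥ u' ≠ 0 →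
      star ((A ⊗ₖ B) *ᵥ productVector u v) ⬝ᵥ ((A ⊗ₖ B) *ᵥ productVector u' v') = 0 →
      star v ⬝ᵥ ((Bᴴ * B) *ᵥ v') = 0 := by
    intro u u' v v' hu h0
    rw [star_kronecker_mulVec_productVector_dotProduct, hα, Matrix.smul_mulVec, Matrix.one_mulVec,
      dotProduct_smul, smul_eq_mul] at h0
    exact (mul_eq_zero.1 h0).resolve_left (mul_ne_zero hα0 hu)
  obtain ⟨t, ht, ht'⟩ := exists_star_stripVector_zero_dotProduct_ket_ne_zero h₁
  obtain ⟨r, hr, hr'⟩ := exists_star_stripVector_one_dotProduct_ket_ne_zero h₁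
  refine StripDiagonal.eq_smul_one rfl h₂ (fun l k hlk => ?_) (fun l k hlk => ?_)
    (fun k => ?_) (fun k => ?_) (fun k => ?_) (fun k => ?_)
  · exact key (star_ket_dotProduct_self_ne_zero (by omega)) (h (.top l) (.top k) (by simpa))
  · exact key (star_ket_dotProduct_self_ne_zero (by omega)) (h (.bottom l) (.bottom k) (by simpa))
  · exact key hr (h (.left r) (.bottom k) (by simp))
  · exact key hr' (h (.bottom k) (.left r) (by simp))
  · exact key ht (h (.right t) (.top k) (by simp))
  · exact key ht' (h (.top k) (.right t) (by simp))

/-- The labels of the states are the labels of the four strips. -/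
def stateLabelEquiv (d₁ d₂ : ℕ) :
    StateLabel d₁ d₂ ≃ (StripLabel d₂ ⊕ StripLabel d₁) ⊕ (StripLabel d₂ ⊕ StripLabel d₁) where
  toFun
    | .top l => .inl (.inl l)
    | .right l => .inl (.inr l)
    | .bottom l => .inr (.inl l)
    | .left l => .inr (.inr l)
  invFun
    | .inl (.inl l) => .top l
    | .inl (.inr l) => .right l
    | .inr (.inl l) => .bottom l
    | .inr (.inr l) => .left l
  left_inv := by rintro (_ | _ | _ | _) <;> rfl
  right_inv := by rintro ((_ | _) | (_ | _)) <;> rfl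

theorem card_stateLabel {d₁ d₂ : ℕ} (h₁ : 2 ≤ d₁) (h₂ : 2 ≤ d₂) :
    Nat.card (StateLabel d₁ d₂) = 2 * (2 * d₁ + 2 * d₂) - 4 := by
  rw [Nat.card_congr (stateLabelEquiv d₁ d₂)]
  simp only [Nat.card_eq_fintype_card, Fintype.card_sum, Fintype.card_prod, Fintype.card_fin,
    Fintype.card_bool]
  omega

/-- Two equal states with different labels would be orthogonal to themselves, hence zero. -/
theorem boundaryState_injective {d₁ d₂ : ℕ} (h₁ : 2 ≤ d₁) (h₂ : 2 ≤ d₂) :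
    Function.Injective (boundaryState d₁ d₂ (2 * d₁) (2 * d₂)) := by
  intro i j hij
  by_contra hne
  have := boundaryState_orthogonal h₁ h₂ hne
  rw [hij, star_dotProduct_self, Complex.ofReal_eq_zero] at this
  exact (sqNorm_pos (boundaryState_ne_zero h₁ h₂ j)).ne' this

theorem theorem5 (d₁ d₂ m n : ℕ) (hm : m = 2 * d₁) (hm4 : 4 ≤ m) (hn : n = 2 * d₂) (hn4 : 4 ≤ n) :
    (Set.range (boundaryState d₁ d₂ m n)).ncard = 2 * (m + n) - 4 ∧
    (∀ i, boundaryState d₁ d₂ m n i ≠ 0) ∧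
    (∀ i j, i ≠ j → star (boundaryState d₁ d₂ m n i) ⬝ᵥ boundaryState d₁ d₂ m n j = 0) ∧
    ¬ LOCCDistinguishable (boundaryState d₁ d₂ m n) := by
  subst hm hn
  have h₁ : 2 ≤ d₁ := by omega
  have h₂ : 2 ≤ d₂ := by omega
  have : Nontrivial (StateLabel d₁ d₂) :=
    ⟨⟨.top (.inl 0), .right (.inl 0), by simp⟩⟩
  refine ⟨?_, boundaryState_ne_zero h₁ h₂, fun i j => boundaryState_orthogonal h₁ h₂,
    not_LOCCDistinguishable_of_rigid (boundaryState_ne_zero h₁ h₂)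
      (aliceRigid_boundaryState h₁ h₂) (bobRigid_boundaryState h₁ h₂)⟩
  rw [← Set.image_univ, Set.ncard_image_of_injective _ (boundaryState_injective h₁ h₂),
    Set.ncard_univ, card_stateLabel h₁ h₂]

end
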